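/- Let $\mathbb{D}=\{w\in\mathbb{C}:|w|<1\}$. For a sequence $\alpha=(\alpha_n)_{n\in\mathbb{Z}}$ in $\mathbb{D}$ put $\rho_n=(1-|\alpha_n|^2)^{1/2}$, and let $\mathcal{E}_\alpha$ be the extended CMV matrix with Verblunsky coefficients $\alpha$, that is, the bounded operator on $\ell^2(\mathbb{Z})$ given, for all $k\in\mathbb{Z}$ and $\psi\in\ell^2(\mathbb{Z})$, by $$(\mathcal{E}_\alpha\psi)_{2k}=\bar\alpha_{2k}\rho_{2k-1}\psi_{2k-1}-\bar\alpha_{2k}\alpha_{2k-1}\psi_{2k}+\bar\alpha_{2k+1}\rho_{2k}\psi_{2k+1}+\rho_{2k+1}\rho_{2k}\psi_{2k+2},$$ $$(\mathcal{E}_\alpha\psi)_{2k+1}=\rho_{2k}\rho_{2k-1}\psi_{2k-1}-\rho_{2k}\alpha_{2k-1}\psi_{2k}-\bar\alpha_{2k+1}\alpha_{2k}\psi_{2k+1}-\rho_{2k+1}\alpha_{2k}\psi_{2k+2}.$$ Let $\nu$ be a Borel probability measure on $\mathbb{D}$ whose topological support $\mathrm{supp}\,\nu$ is contained in $[0,1]$.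 Then $a=\min\mathrm{supp}\,\nu$ exists, and the almost sure spectrum of the extended CMV matrices with independent, $\nu$-distributed Verblunsky coefficients is $$\Sigma=\{e^{i\theta}:\theta\in[-\pi,\pi),\ |\theta|\ge 2\arcsin a\}=\partial\mathbb{D}\setminus R_a,\qquad R_a=\{e^{i\theta}:-2\arcsin a<\theta<2\arcsin a\}$$ (with $R_0=\emptyset$). That is, $\Sigma$ is a closed subset of $\partial\mathbb{D}$, and $\sigma(\mathcal{E}_\omega)=\Sigma$ for almost every $\omega\in\mathbb{D}^{\mathbb{Z}}$ with respect to the product measure $\nu^{\mathbb{Z}}$. -/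

import Mathlib

open MeasureTheory

/-- The open unit disk of the complex plane (a subtype of `ℂ`, with the subspace topology and its
Borel σ-algebra). -/
abbrev Disk : Type := Metric.ball (0 : ℂ) 1

/-- The Hilbert space `ℓ²(ℤ)` of square-summable complex sequences. -/
abbrev EllTwo : Type := lp (fun _ : ℤ => ℂ) 2

/-- `ρ(α) = (1 - |α|²)^{1/2}`, regarded as a complex number. -/
noncomputable def rho (α : Disk) : ℂ := (Real.sqrt (1 - ‖(α : ℂ)‖ ^ 2) : ℝ)

/-- The entry in row `n` and column `m` of the (five-diagonal) extended CMV matrix with Verblunsky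
coefficients `(α n)`, `n ∈ ℤ`. The nonzero entries in the even row `n = 2k` are
`conj α_{2k} ρ_{2k-1}`, `- conj α_{2k} α_{2k-1}`, `conj α_{2k+1} ρ_{2k}`, `ρ_{2k+1} ρ_{2k}`
in the columns `2k-1`, `2k`, `2k+1`, `2k+2`; those in the odd row `n = 2k+1` are
`ρ_{2k} ρ_{2k-1}`, `- ρ_{2k} α_{2k-1}`, `- conj α_{2k+1} α_{2k}`, `- ρ_{2k+1} α_{2k}`
in the columns `2k-1`, `2k`, `2k+1`, `2k+2`. -/
noncomputable def cmvMatrix (α : ℤ → Disk) : Matrix ℤ ℤ ℂ := fun n m =>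
  if Even n then
    if m = n - 1 then star (α n : ℂ) * rho (α (n - 1))
    else if m = n then - (star (α n : ℂ) * (α (n - 1) : ℂ))
    else if m = n + 1 then star (α (n + 1) : ℂ) * rho (α n)
    else if m = n + 2 then rho (α (n + 1)) * rho (α n)
    else 0
  else
    if m = n - 2 then rho (α (n - 1)) * rho (α (n - 2))
    else if m = n - 1 then - (rho (α (n - 1)) * (α (n - 2) : ℂ))
    else if m = n then - (star (α n : ℂ) * (α (n - 1) : ℂ))
    else if m = n + 1 then - (rho (α n) * (α (n - 1) : ℂ))
    else 0

/-- The matrix-vector product `(𝓔 ψ)(n) = ∑_m 𝓔_{n,m} ψ(m)`; as `𝓔_{n,m} = 0` for `|n - m| > 2`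
(see `cmvMatrix_eq_zero`), the sum is written over `m = n + d` with `-2 ≤ d ≤ 2`. -/
noncomputable def cmvApply (α : ℤ → Disk) (ψ : ℤ → ℂ) : ℤ → ℂ := fun n =>
  ∑ d ∈ Finset.Icc (-2 : ℤ) 2, cmvMatrix α n (n + d) * ψ (n + d)

theorem cmvMatrix_eq_zero (α : ℤ → Disk) (n m : ℤ) (h : 2 < |m - n|) :
    cmvMatrix α n m = 0 := by
  have h' : m ≠ n - 2 ∧ m ≠ n - 1 ∧ m ≠ n ∧ m ≠ n + 1 ∧ m ≠ n + 2 := by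
    refine ⟨?_, ?_, ?_, ?_, ?_⟩ <;> rintro rfl <;> simp at h
  simp [cmvMatrix, h']

theorem norm_disk_le (α : Disk) : ‖(α : ℂ)‖ ≤ 1 :=
  le_of_lt (mem_ball_zero_iff.1 α.2)

theorem norm_rho_le (α : Disk) : ‖rho α‖ ≤ 1 := by
  rw [rho, Complex.norm_real, Real.norm_of_nonneg (Real.sqrt_nonneg _)]
  exact Real.sqrt_le_one.2 (by nlinarith [norm_nonneg (α : ℂ)])

theorem norm_cmvMatrix_le (α : ℤ → Disk) (n m : ℤ) : ‖cmvMatrix α n m‖ ≤ 1 := by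
  have h1 := fun k => norm_disk_le (α k)
  have h2 := fun k => norm_rho_le (α k)
  unfold cmvMatrix
  split_ifs <;> simp only [norm_neg, norm_mul, norm_star, norm_zero] <;>
    first
      | exact zero_le_one
      | exact mul_le_one₀ (by first | exact h1 _ | exact h2 _) (norm_nonneg _)
          (by first | exact h1 _ | exact h2 _)

theorem memℓp_shift (ψ : EllTwo) (d : ℤ) :
    Memℓp (fun n : ℤ => (ψ (n + d) : ℂ)) 2 := by
  have h := lp.memℓp ψ
  rw [memℓp_gen_iff (by norm_num)] at h ⊢
  exact (Equiv.addRight d).summable_iff.2 h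

theorem norm_shift (ψ : EllTwo) (d : ℤ) :
    ‖(⟨fun n : ℤ => (ψ (n + d) : ℂ), memℓp_shift ψ d⟩ : EllTwo)‖ = ‖ψ‖ := by
  rw [lp.norm_eq_tsum_rpow (by norm_num), lp.norm_eq_tsum_rpow (by norm_num)]
  congr 1
  exact (Equiv.addRight d).tsum_eq (fun n => ‖(ψ n : ℂ)‖ ^ (2 : ENNReal).toReal)

theorem memℓp_cmvTerm (α : ℤ → Disk) (d : ℤ) (ψ : EllTwo) :
    Memℓp (fun n : ℤ => cmvMatrix α n (n + d) * (ψ (n + d) : ℂ)) 2 := by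
  have h := memℓp_shift ψ d
  rw [memℓp_gen_iff (by norm_num)] at h ⊢
  refine h.of_nonneg_of_le (fun n => by positivity) (fun n => ?_)
  refine Real.rpow_le_rpow (norm_nonneg _) ?_ (by norm_num)
  rw [norm_mul]
  exact mul_le_of_le_one_left (norm_nonneg _) (norm_cmvMatrix_le α _ _)

/-- One of the five diagonals of the extended CMV matrix, as a bounded operator on `ℓ²(ℤ)`. -/
noncomputable def cmvDiagonal (α : ℤ → Disk) (d : ℤ) : EllTwo →L[ℂ] EllTwo :=
  LinearMap.mkContinuous
    { toFun := fun ψ => ⟨fun n : ℤ => cmvMatrix α n (n + d) * (ψ (n + d) : ℂ),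
        memℓp_cmvTerm α d ψ⟩
      map_add' := fun ψ φ => by
        ext n
        exact mul_add _ _ _
      map_smul' := fun c ψ => by
        ext n
        exact mul_left_comm _ _ _ }
    1 (fun ψ => by
      rw [one_mul, ← norm_shift ψ d]
      refine lp.norm_mono (by norm_num) (fun n => ?_)
      change ‖cmvMatrix α n (n + d) * (ψ (n + d) : ℂ)‖ ≤ ‖(ψ (n + d) : ℂ)‖
      rw [norm_mul]
      exact mul_le_of_le_one_left (norm_nonneg _) (norm_cmvMatrix_le α _ _))

/-- The extended CMV matrix with Verblunsky coefficients `α`, as a bounded operator on `ℓ²(ℤ)`: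
the sum of its five diagonals. By `extendedCMV_apply` it acts as the matrix `cmvMatrix α`. -/
noncomputable def extendedCMV (α : ℤ → Disk) : EllTwo →L[ℂ] EllTwo :=
  ∑ d ∈ Finset.Icc (-2 : ℤ) 2, cmvDiagonal α d

theorem extendedCMV_apply (α : ℤ → Disk) (ψ : EllTwo) (n : ℤ) :
    (extendedCMV α ψ : EllTwo) n = cmvApply α (fun m => ψ m) n := by
  simp only [extendedCMV, cmvApply, _root_.sum_apply, lp.coeFn_sum,
    Finset.sum_apply]
  rfl

/-- `Sig` is the almost sure spectrum of the extended CMV matrices whose Verblunsky coefficients are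
independent with common distribution `ν`: it is a closed subset of the unit circle, and for almost
every `ω` with respect to the product measure `ν^ℤ`, the spectrum of the extended CMV matrix with
coefficients `(ω n)` equals `Sig`. -/
def IsAlmostSureSpectrum (ν : Measure Disk) [IsProbabilityMeasure ν] (Sig : Set ℂ) : Prop :=
  IsClosed Sig ∧ Sig ⊆ Metric.sphere (0 : ℂ) 1 ∧
    ∀ᵐ ω ∂(Measure.infinitePi (fun _ : ℤ => ν)), spectrum ℂ (extendedCMV ω) = Sig

/-- The open arc `R_a = {e^{iθ} : -2 arcsin a < θ < 2 arcsin a}` (empty for `a = 0`). -/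
def gapArc (a : ℝ) : Set ℂ :=
  {z | ∃ θ : ℝ, -(2 * Real.arcsin a) < θ ∧ θ < 2 * Real.arcsin a ∧
    z = Complex.exp (θ * Complex.I)}

/-- The real points of the topological support of `ν`. -/
def realSupport (ν : Measure Disk) : Set ℝ :=
  {t : ℝ | ∃ α ∈ ν.support, (α : ℂ) = (t : ℂ)}

/-!
Write `ρ(α)² = 1 - |α|²`. The extended CMV matrix factors as `L * M`, where `L` and `M` are direct
sums of unitary `2 × 2` blocks, so its spectrum lies on the unit circle. If the coefficients are
real, then `L² = M² = 1`; hence `(L + M)² = 2 + u + u⁻¹` for `u = L * M`, and `u` is similar to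
`u⁻¹ = M * L`, so a point `z` of the circle is in the spectrum of `u` if and only if `2 + 2 Re z` is
in the spectrum of `(L + M)²`. The diagonal of the tridiagonal operator `L + M` consists of
differences of consecutive coefficients, so `L + M` does not change if `a` is subtracted from all of
them; as `(α - a)² + ρ(α)² ≤ 1 - a²` for `α ≥ a`, this gives `‖L + M‖ ≤ 2 √(1 - a²)`.
Conversely, almost surely there are arbitrarily long stretches on which all coefficients are close
to `a` (second Borel-Cantelli lemma), and plane waves truncated to them show that `L + M` has every
point `2 √(1 - a²) cos θ` in its spectrum.
-/

section Spectrum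

theorem mem_spectrum_of_forall_exists_norm_sub_le {𝕜 E : Type*} [NontriviallyNormedField 𝕜]
    [NormedAddCommGroup E] [NormedSpace 𝕜 E] {T : E →L[𝕜] E} {z : 𝕜}
    (h : ∀ ε > 0, ∃ v ≠ 0, ‖T v - z • v‖ ≤ ε * ‖v‖) : z ∈ spectrum 𝕜 T := by
  rw [spectrum.mem_iff]
  intro hu
  obtain ⟨S, hS⟩ := hu.exists_left_inv
  obtain ⟨v, hv, hle⟩ := h (1 / (‖S‖ + 1)) (by positivity)
  have hSv : S (z • v - T v) = v := by
    simpa [Algebra.algebraMap_eq_smul_one] using congrArg (fun R : E →L[𝕜] E => R v) hS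
  have hv0 : 0 < ‖v‖ := norm_pos_iff.2 hv
  have : ‖v‖ < ‖v‖ := calc
    ‖v‖ = ‖S (z • v - T v)‖ := by rw [hSv]
    _ ≤ ‖S‖ * ‖z • v - T v‖ := S.le_opNorm _
    _ ≤ ‖S‖ * (1 / (‖S‖ + 1) * ‖v‖) := by
      rw [norm_sub_rev]
      gcongr
    _ = ‖S‖ / (‖S‖ + 1) * ‖v‖ := by ring
    _ < 1 * ‖v‖ :=
      mul_lt_mul_of_pos_right ((div_lt_one (by positivity)).2 (lt_add_one _)) hv0
    _ = ‖v‖ := one_mul _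
  exact this.false

theorem norm_eq_one_of_mem_spectrum {𝕜 A : Type*} [NontriviallyNormedField 𝕜] [NormedRing A]
    [NormedAlgebra 𝕜 A] [CompleteSpace A] [NormOneClass A] {u : Aˣ} (hu : ‖(u : A)‖ ≤ 1)
    (hu' : ‖(↑u⁻¹ : A)‖ ≤ 1) {z : 𝕜} (hz : z ∈ spectrum 𝕜 (u : A)) : ‖z‖ = 1 := by
  have : Nontrivial A := NormOneClass.nontrivial
  have hz0 : z ≠ 0 := spectrum.ne_zero_of_mem_of_unit hz
  have hle : ‖z‖ ≤ 1 := (spectrum.norm_le_norm_of_mem hz).trans hu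
  have hinv : z⁻¹ ∈ spectrum 𝕜 (↑u⁻¹ : A) := spectrum.inv₀_mem_inv_iff.2 hz
  have hle' : ‖z⁻¹‖ ≤ 1 := (spectrum.norm_le_norm_of_mem hinv).trans hu'
  rw [norm_inv] at hle'
  exact hle.antisymm ((inv_le_one₀ (norm_pos_iff.2 hz0)).1 hle')

variable {K A : Type*} [Field K] [Ring A] [Algebra K A] {a b : A}

theorem two_add_inv_sub_sq_add_eq_smul_mul (ha : a * a = 1) (hb : b * b = 1) {z : K}
    (hz : z ≠ 0) : algebraMap K A (2 + z + z⁻¹) - (a + b) ^ 2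
      = z⁻¹ • ((algebraMap K A z - a * b) * (algebraMap K A z - b * a)) := by
  have hab : a * b * (b * a) = 1 := by rw [mul_assoc, ← mul_assoc b, hb, one_mul, ha]
  simp only [Algebra.algebraMap_eq_smul_one, sq, add_mul, mul_add, mul_sub, sub_mul, ha, hb, hab,
    add_smul, mul_smul_comm, smul_mul_assoc, mul_one, one_mul, smul_sub]
  match_scalars <;> field_simp
  ring

theorem mem_spectrum_mul_iff_of_mul_self_eq_one (ha : a * a = 1) (hb : b * b = 1) {z : K}
    (hz : z ≠ 0) : z ∈ spectrum K (a * b) ↔ 2 + z + z⁻¹ ∈ spectrum K ((a + b) ^ 2) := by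
  have hcomm : Commute (algebraMap K A z - a * b) (algebraMap K A z - b * a) := by
    have huv : Commute (a * b) (b * a) := by
      rw [commute_iff_eq, mul_assoc, ← mul_assoc b, hb, one_mul, ha, mul_assoc, ← mul_assoc a, ha,
        one_mul, hb]
    have hscalar : ∀ w : A, Commute (algebraMap K A z) w := Algebra.commutes z
    exact ((hscalar _).sub_right (hscalar _)).sub_left ((hscalar _).symm.sub_right huv)
  have hswap : IsUnit (algebraMap K A z - b * a) ↔ IsUnit (algebraMap K A z - a * b) := by
    have := Set.ext_iff.1 (spectrum.nonzero_mul_comm (𝕜 := K) b a) z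
    simpa [hz, spectrum.mem_iff, not_iff_not] using this
  rw [spectrum.mem_iff, spectrum.mem_iff, not_iff_not,
    two_add_inv_sub_sq_add_eq_smul_mul ha hb hz, ← Units.smul_mk0 (inv_ne_zero hz), isUnit_smul_iff,
    hcomm.isUnit_mul_iff, hswap, and_self]

end Spectrum

section EllTwo

theorem EllTwo.hasSum_norm_sq (ψ : EllTwo) : HasSum (fun n => ‖ψ n‖ ^ 2) (‖ψ‖ ^ 2) := by
  simpa using lp.hasSum_norm (p := 2) (by norm_num) ψ

theorem memℓp_two_of_summable_sq {ι : Type*} {f : ι → ℂ} (hf : Summable fun n => ‖f n‖ ^ 2) :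
    Memℓp f 2 := by
  rw [memℓp_gen_iff (by norm_num)]
  simpa using hf

instance EllTwo.nontrivial : Nontrivial EllTwo :=
  ⟨⟨lp.single 2 0 1, 0, fun h => by simpa using congrArg (fun ψ : EllTwo => ψ 0) h⟩⟩

theorem summable_and_tsum_le_of_involutive {ι : Type*} {σ : ι → ι} (hσ : Function.Involutive σ)
    {f g : ι → ℝ} (hf : ∀ n, 0 ≤ f n) (hg : Summable g)
    (h : ∀ n, f n + f (σ n) ≤ g n + g (σ n)) : Summable f ∧ ∑' n, f n ≤ ∑' n, g n := by
  let e : Equiv.Perm ι := hσ.toPerm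
  have hgσ : Summable (g ∘ e) := e.summable_iff.2 hg
  have hsum : Summable f := (hg.add hgσ).of_nonneg_of_le hf fun n =>
    (le_add_of_nonneg_right (hf _)).trans (h n)
  have hfσ : Summable (f ∘ e) := e.summable_iff.2 hsum
  refine ⟨hsum, ?_⟩
  have hle : ∑' n, (f n + (f ∘ e) n) ≤ ∑' n, (g n + (g ∘ e) n) :=
    (hsum.add hfσ).tsum_le_tsum h (hg.add hgσ)
  rw [hsum.tsum_add hfσ, hg.tsum_add hgσ,
    show ∑' n, (f ∘ e) n = ∑' n, f n from e.tsum_eq f,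
    show ∑' n, (g ∘ e) n = ∑' n, g n from e.tsum_eq g] at hle
  linarith

end EllTwo

section Block

open scoped BoundedContinuousFunction

/-- The direct sum over `n ∈ s + 2ℤ` of the matrices `!![conj x n, conj y n; y n, -x n]` acting on
the sites `n`, `n + 1`. Only the values of `x` and `y` on `s + 2ℤ` matter. -/
noncomputable def blockApply (s : ℤ) (x y ψ : ℤ → ℂ) : ℤ → ℂ := fun n =>
  if Even (n - s) then star (x n) * ψ n + star (y n) * ψ (n + 1)
  else y (n - 1) * ψ (n - 1) - x (n - 1) * ψ n

/-- The other site of the block of `blockApply s` that contains `n`. -/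
def blockPartner (s n : ℤ) : ℤ := if Even (n - s) then n + 1 else n - 1

variable {s n : ℤ}

theorem blockApply_of_even (h : Even (n - s)) (x y ψ : ℤ → ℂ) :
    blockApply s x y ψ n = star (x n) * ψ n + star (y n) * ψ (n + 1) := if_pos h

theorem blockApply_of_not_even (h : ¬ Even (n - s)) (x y ψ : ℤ → ℂ) :
    blockApply s x y ψ n = y (n - 1) * ψ (n - 1) - x (n - 1) * ψ n := if_neg h

theorem not_even_add_one_sub (h : Even (n - s)) : ¬ Even (n + 1 - s) := by grind

theorem even_sub_one_sub (h : ¬ Even (n - s)) : Even (n - 1 - s) := by grind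

theorem involutive_blockPartner (s : ℤ) : Function.Involutive (blockPartner s) := by
  intro n
  grind [blockPartner]

theorem norm_sq_add_norm_sq_block (x y u w : ℂ) :
    ‖star x * u + star y * w‖ ^ 2 + ‖y * u - x * w‖ ^ 2
      = (‖x‖ ^ 2 + ‖y‖ ^ 2) * (‖u‖ ^ 2 + ‖w‖ ^ 2) := by
  simp only [Complex.sq_norm, Complex.normSq_apply, Complex.add_re, Complex.add_im, Complex.sub_re,
    Complex.sub_im, Complex.mul_re, Complex.mul_im, Complex.star_def, Complex.conj_re,
    Complex.conj_im]
  ring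

theorem norm_sq_blockApply_add_blockPartner_le {x y ψ : ℤ → ℂ} {c : ℝ}
    (h : ∀ n, ψ n ≠ 0 ∨ ψ (n + 1) ≠ 0 → ‖x n‖ ^ 2 + ‖y n‖ ^ 2 ≤ c ^ 2) (s n : ℤ) :
    ‖blockApply s x y ψ n‖ ^ 2 + ‖blockApply s x y ψ (blockPartner s n)‖ ^ 2
      ≤ c ^ 2 * ‖ψ n‖ ^ 2 + c ^ 2 * ‖ψ (blockPartner s n)‖ ^ 2 := by
  have hblock : ∀ k, Even (k - s) →
      ‖blockApply s x y ψ k‖ ^ 2 + ‖blockApply s x y ψ (k + 1)‖ ^ 2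
        ≤ c ^ 2 * ‖ψ k‖ ^ 2 + c ^ 2 * ‖ψ (k + 1)‖ ^ 2 := fun k hk => by
    rw [blockApply_of_even hk, blockApply_of_not_even (not_even_add_one_sub hk),
      add_sub_cancel_right, norm_sq_add_norm_sq_block, ← mul_add]
    by_cases h0 : ψ k ≠ 0 ∨ ψ (k + 1) ≠ 0
    · gcongr
      exact h k h0
    · push Not at h0
      simp [h0.1, h0.2]
  by_cases hn : Even (n - s)
  · rw [blockPartner, if_pos hn]
    exact hblock n hn
  · rw [blockPartner, if_neg hn]
    have := hblock (n - 1) (even_sub_one_sub hn)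
    rw [sub_add_cancel] at this
    linarith

theorem blockApply_summable_and_tsum_le {x y : ℤ → ℂ} {c : ℝ} {ψ : EllTwo}
    (h : ∀ n, ψ n ≠ 0 ∨ ψ (n + 1) ≠ 0 → ‖x n‖ ^ 2 + ‖y n‖ ^ 2 ≤ c ^ 2) (s : ℤ) :
    (Summable fun n => ‖blockApply s x y ψ n‖ ^ 2) ∧
      ∑' n, ‖blockApply s x y ψ n‖ ^ 2 ≤ c ^ 2 * ‖ψ‖ ^ 2 := by
  have hψ := ψ.hasSum_norm_sq.mul_left (c ^ 2)
  rw [← hψ.tsum_eq]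
  exact summable_and_tsum_le_of_involutive (involutive_blockPartner s) (fun n => sq_nonneg _)
    hψ.summable (norm_sq_blockApply_add_blockPartner_le h s)

theorem norm_sq_add_norm_sq_le_of_bounded (x y : ℤ →ᵇ ℂ) (n : ℤ) :
    ‖x n‖ ^ 2 + ‖y n‖ ^ 2 ≤ √(‖x‖ ^ 2 + ‖y‖ ^ 2) ^ 2 := by
  rw [Real.sq_sqrt (by positivity)]
  gcongr <;> exact BoundedContinuousFunction.norm_coe_le_norm _ n

/-- `blockApply` as a bounded operator on `ℓ²(ℤ)`. -/
noncomputable def blockOp (s : ℤ) (x y : ℤ →ᵇ ℂ) : EllTwo →L[ℂ] EllTwo :=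
  LinearMap.mkContinuous
    { toFun := fun ψ => ⟨blockApply s x y ψ, memℓp_two_of_summable_sq
        (blockApply_summable_and_tsum_le
          (fun n _ => norm_sq_add_norm_sq_le_of_bounded x y n) s).1⟩
      map_add' := fun ψ φ => by
        ext n
        simp only [blockApply, lp.coeFn_add, Pi.add_apply]
        split_ifs <;> ring
      map_smul' := fun a ψ => by
        ext n
        simp only [blockApply, lp.coeFn_smul, Pi.smul_apply, smul_eq_mul, RingHom.id_apply]
        split_ifs <;> ring }
    √(‖x‖ ^ 2 + ‖y‖ ^ 2) (fun ψ => by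
      refine le_of_sq_le_sq ?_ (by positivity)
      rw [mul_pow, ← (EllTwo.hasSum_norm_sq _).tsum_eq]
      exact (blockApply_summable_and_tsum_le
        (fun n _ => norm_sq_add_norm_sq_le_of_bounded x y n) s).2)

theorem blockOp_apply (s : ℤ) (x y : ℤ →ᵇ ℂ) (ψ : EllTwo) (n : ℤ) :
    blockOp s x y ψ n = blockApply s x y ψ n := rfl

theorem norm_blockOp_apply_le {x y : ℤ →ᵇ ℂ} {c : ℝ} (hc : 0 ≤ c) {ψ : EllTwo}
    (h : ∀ n, ψ n ≠ 0 ∨ ψ (n + 1) ≠ 0 → ‖x n‖ ^ 2 + ‖y n‖ ^ 2 ≤ c ^ 2) (s : ℤ) :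
    ‖blockOp s x y ψ‖ ≤ c * ‖ψ‖ := by
  refine le_of_sq_le_sq ?_ (by positivity)
  rw [mul_pow, ← (EllTwo.hasSum_norm_sq _).tsum_eq]
  exact (blockApply_summable_and_tsum_le h s).2

theorem norm_blockOp_le {x y : ℤ →ᵇ ℂ} {c : ℝ} (hc : 0 ≤ c)
    (h : ∀ n, ‖x n‖ ^ 2 + ‖y n‖ ^ 2 ≤ c ^ 2) (s : ℤ) : ‖blockOp s x y‖ ≤ c :=
  (blockOp s x y).opNorm_le_bound hc fun _ => norm_blockOp_apply_le hc (fun n _ => h n) s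

theorem blockOp_sub (s : ℤ) (x y x' y' : ℤ →ᵇ ℂ) :
    blockOp s (x - x') (y - y') = blockOp s x y - blockOp s x' y' := by
  ext ψ n
  simp only [blockOp_apply, sub_apply, lp.coeFn_sub, Pi.sub_apply, blockApply,
    BoundedContinuousFunction.coe_sub, star_sub]
  split_ifs <;> ring

theorem blockOp_mul_blockOp_star (s : ℤ) {x y : ℤ →ᵇ ℂ} (h : ∀ n, ‖x n‖ ^ 2 + ‖y n‖ ^ 2 = 1) :
    blockOp s x y * blockOp s (star x) y = 1 := by
  have hC : ∀ k, star (x k) * x k + star (y k) * y k = 1 := fun k => by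
    simp only [Complex.star_def, Complex.conj_mul']
    exact_mod_cast h k
  ext ψ n
  change blockApply s x y (blockApply s (star x) y ψ) n = ψ n
  by_cases hn : Even (n - s)
  · rw [blockApply_of_even hn, blockApply_of_even hn,
      blockApply_of_not_even (not_even_add_one_sub hn), add_sub_cancel_right]
    simp only [Pi.star_apply, star_star]
    linear_combination (ψ n) * hC n
  · rw [blockApply_of_not_even hn, blockApply_of_not_even hn,
      blockApply_of_even (even_sub_one_sub hn), sub_add_cancel]
    simp only [Pi.star_apply, star_star]
    linear_combination (ψ n) * hC (n - 1)

end Block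

section BlockSum

open scoped BoundedContinuousFunction
open BoundedContinuousFunction (const)

/-- A tridiagonal operator, see `blockSum_apply`. For the Verblunsky coefficients `x` and
`y n = √(1 - |x n|²)` it is the sum of the two factors of the extended CMV matrix. -/
noncomputable def blockSum (x y : ℤ →ᵇ ℂ) : EllTwo →L[ℂ] EllTwo := blockOp 0 x y + blockOp 1 x y

theorem blockSum_apply (x y : ℤ →ᵇ ℂ) (ψ : EllTwo) (n : ℤ) :
    blockSum x y ψ n
      = y (n - 1) * ψ (n - 1) + (star (x n) - x (n - 1)) * ψ n + star (y n) * ψ (n + 1) := by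
  change blockApply 0 x y ψ n + blockApply 1 x y ψ n = _
  by_cases hn : Even (n - 0)
  · rw [blockApply_of_even hn, blockApply_of_not_even (by grind)]
    ring
  · rw [blockApply_of_not_even hn, blockApply_of_even (by grind)]
    ring

theorem blockSum_sub (x y x' y' : ℤ →ᵇ ℂ) :
    blockSum (x - x') (y - y') = blockSum x y - blockSum x' y' := by
  simp only [blockSum, blockOp_sub]
  abel

theorem blockSum_sub_const_ofReal (x y : ℤ →ᵇ ℂ) (a : ℝ) :
    blockSum (x - const ℤ (a : ℂ)) y = blockSum x y := by
  ext ψ n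
  simp only [blockSum_apply, BoundedContinuousFunction.coe_sub, Pi.sub_apply,
    BoundedContinuousFunction.const_apply, star_sub, Complex.star_def, Complex.conj_ofReal]
  ring

theorem norm_blockSum_apply_le {x y : ℤ →ᵇ ℂ} {c : ℝ} (hc : 0 ≤ c) {ψ : EllTwo}
    (h : ∀ n, ψ n ≠ 0 ∨ ψ (n + 1) ≠ 0 → ‖x n‖ ^ 2 + ‖y n‖ ^ 2 ≤ c ^ 2) :
    ‖blockSum x y ψ‖ ≤ 2 * c * ‖ψ‖ :=
  calc
    ‖blockSum x y ψ‖ ≤ ‖blockOp 0 x y ψ‖ + ‖blockOp 1 x y ψ‖ := norm_add_le _ _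
    _ ≤ c * ‖ψ‖ + c * ‖ψ‖ :=
      add_le_add (norm_blockOp_apply_le hc h 0) (norm_blockOp_apply_le hc h 1)
    _ = 2 * c * ‖ψ‖ := by ring

theorem norm_blockSum_le {x y : ℤ →ᵇ ℂ} {c : ℝ} (hc : 0 ≤ c)
    (h : ∀ n, ‖x n‖ ^ 2 + ‖y n‖ ^ 2 ≤ c ^ 2) : ‖blockSum x y‖ ≤ 2 * c :=
  (blockSum x y).opNorm_le_bound (by positivity) fun _ =>
    norm_blockSum_apply_le hc fun n _ => h n

end BlockSum

section PlaneWave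

open scoped BoundedContinuousFunction
open BoundedContinuousFunction (const)

/-- The point `p` is approximated by `ω` along arbitrarily long blocks of consecutive indices. -/
def HasStretchesNear {X : Type*} [TopologicalSpace X] (ω : ℤ → X) (p : X) : Prop :=
  ∀ U ∈ nhds p, ∀ N : ℕ, ∃ m : ℤ, ∀ j ∈ Set.Ico m (m + N), ω j ∈ U

theorem HasStretchesNear.comp_continuousAt {X Y : Type*} [TopologicalSpace X] [TopologicalSpace Y]
    {ω : ℤ → X} {p : X} {f : X → Y} (h : HasStretchesNear ω p) (hf : ContinuousAt f p) :
    HasStretchesNear (f ∘ ω) (f p) := fun U hU N => h (f ⁻¹' U) (hf hU) N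

/-- The plane wave `n ↦ μ ^ n` restricted to the sites `m, …, m + N - 1`. -/
noncomputable def planeWave (μ : ℂ) (m : ℤ) (N : ℕ) : EllTwo :=
  ∑ j ∈ Finset.Ico m (m + N), lp.single 2 j (μ ^ j)

/-- The symbol of the translation invariant operator `blockSum (const ℤ p) (const ℤ r)`. -/
noncomputable def blockSymbol (p r μ : ℂ) : ℂ := r * μ⁻¹ + (star p - p) + star r * μ

variable {μ : ℂ} {m : ℤ} {N : ℕ}

theorem planeWave_apply_of_notMem {n : ℤ} (hn : n ∉ Finset.Ico m (m + N)) :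
    planeWave μ m N n = 0 := by
  simp only [planeWave, lp.coeFn_sum, Finset.sum_apply, lp.coeFn_single]
  exact Finset.sum_eq_zero fun j hj => Pi.single_eq_of_ne (ne_of_mem_of_not_mem hj hn).symm _

theorem norm_planeWave (hμ : ‖μ‖ = 1) (m : ℤ) (N : ℕ) : ‖planeWave μ m N‖ = √N := by
  have h := lp.norm_sum_single (p := 2) (by norm_num) (fun j : ℤ => μ ^ j) (Finset.Ico m (m + N))
  simp only [norm_zpow, hμ, one_zpow, one_pow, Finset.sum_const, Int.card_Ico,
    add_sub_cancel_left, Int.toNat_natCast, nsmul_eq_mul, mul_one, ENNReal.toReal_ofNat,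
    Real.rpow_ofNat] at h
  rw [← h, planeWave, Real.sqrt_sq (norm_nonneg _)]

theorem blockSum_const_single (p r c : ℂ) (j : ℤ) :
    blockSum (const ℤ p) (const ℤ r) (lp.single 2 j c)
      = lp.single 2 (j - 1) (star r * c) + lp.single 2 j ((star p - p) * c)
        + lp.single 2 (j + 1) (r * c) := by
  ext n
  simp only [blockSum_apply, lp.coeFn_add, Pi.add_apply, lp.coeFn_single, Pi.single_apply,
    BoundedContinuousFunction.const_apply]
  grind

theorem sum_Ico_sub_succ {G : Type*} [AddCommGroup G] (f : ℤ → G) (m : ℤ) (N : ℕ) :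
    ∑ j ∈ Finset.Ico m (m + N), (f j - f (j + 1)) = f m - f (m + N) := by
  induction N with
  | zero => simp
  | succ N ih =>
    rw [Nat.cast_succ, ← add_assoc, ← Finset.insert_Ico_right_eq_Ico_add_one (by lia),
      Finset.sum_insert Finset.right_notMem_Ico, ih]
    abel

theorem norm_blockSum_const_planeWave_sub_le (p r : ℂ) (hμ : ‖μ‖ = 1) (m : ℤ) (N : ℕ) :
    ‖blockSum (const ℤ p) (const ℤ r) (planeWave μ m N) - blockSymbol p r μ • planeWave μ m N‖
      ≤ 4 * ‖r‖ := by
  have hμ0 : μ ≠ 0 := norm_ne_zero_iff.1 (by simp [hμ])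
  let A : ℤ → EllTwo := fun j =>
    lp.single 2 (j - 1) (star r * μ ^ j) - lp.single 2 j (r * μ ^ (j - 1))
  have hA : ∀ j, ‖A j‖ ≤ 2 * ‖r‖ := fun j => by
    refine (norm_sub_le _ _).trans_eq ?_
    simp only [lp.norm_single two_pos, norm_mul, norm_star, norm_zpow, hμ, one_zpow, mul_one]
    ring
  have hstep : ∀ j : ℤ, blockSum (const ℤ p) (const ℤ r) (lp.single 2 j (μ ^ j))
      - blockSymbol p r μ • lp.single 2 j (μ ^ j) = A j - A (j + 1) := fun j => by
    ext n
    simp only [blockSum_const_single, A, blockSymbol, lp.coeFn_add, lp.coeFn_sub, lp.coeFn_smul,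
      Pi.add_apply, Pi.sub_apply, Pi.smul_apply, smul_eq_mul, lp.coeFn_single, Pi.single_apply,
      add_sub_cancel_right, zpow_add_one₀ hμ0, zpow_sub_one₀ hμ0]
    grind
  have hsum : blockSum (const ℤ p) (const ℤ r) (planeWave μ m N)
      - blockSymbol p r μ • planeWave μ m N = A m - A (m + N) := by
    rw [planeWave, map_sum, Finset.smul_sum, ← Finset.sum_sub_distrib,
      Finset.sum_congr rfl fun j _ => hstep j, sum_Ico_sub_succ]
  rw [hsum]
  linarith [norm_sub_le (A m) (A (m + N)), hA m, hA (m + N)]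

theorem norm_blockSum_planeWave_sub_le {x y : ℤ →ᵇ ℂ} {p r : ℂ} {c : ℝ} (hc : 0 ≤ c)
    (h : ∀ n ∈ Set.Ico (m - 1) (m + N), ‖x n - p‖ ≤ c ∧ ‖y n - r‖ ≤ c) (hμ : ‖μ‖ = 1) :
    ‖blockSum x y (planeWave μ m N) - blockSymbol p r μ • planeWave μ m N‖
      ≤ 4 * c * √N + 4 * ‖r‖ := by
  let v := planeWave μ m N
  have hloc : ∀ n, v n ≠ 0 ∨ v (n + 1) ≠ 0 →
      ‖(x - const ℤ p) n‖ ^ 2 + ‖(y - const ℤ r) n‖ ^ 2 ≤ (2 * c) ^ 2 := fun n hn => by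
    have hmem : n ∈ Set.Ico (m - 1) (m + N) := by
      by_contra hout
      rw [Set.mem_Ico] at hout
      rcases hn with hn | hn <;>
        exact hn (planeWave_apply_of_notMem (by rw [Finset.mem_Ico]; lia))
    obtain ⟨hx, hy⟩ := h n hmem
    change ‖x n - p‖ ^ 2 + ‖y n - r‖ ^ 2 ≤ (2 * c) ^ 2
    calc
      ‖x n - p‖ ^ 2 + ‖y n - r‖ ^ 2 ≤ c ^ 2 + c ^ 2 := by gcongr
      _ ≤ (2 * c) ^ 2 := by nlinarith [sq_nonneg c]
  calc
    ‖blockSum x y v - blockSymbol p r μ • v‖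
      = ‖blockSum (x - const ℤ p) (y - const ℤ r) v
          + (blockSum (const ℤ p) (const ℤ r) v - blockSymbol p r μ • v)‖ := by
        rw [blockSum_sub, sub_apply]
        congr 1
        abel
    _ ≤ 2 * (2 * c) * ‖v‖ + 4 * ‖r‖ :=
        norm_add_le_of_le (norm_blockSum_apply_le (by positivity) hloc)
          (norm_blockSum_const_planeWave_sub_le p r hμ m N)
    _ = 4 * c * √N + 4 * ‖r‖ := by
        rw [norm_planeWave hμ]
        ring

theorem blockSymbol_mem_spectrum {x y : ℤ →ᵇ ℂ} {p r : ℂ}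
    (h : HasStretchesNear (fun n => (x n, y n)) (p, r)) (hμ : ‖μ‖ = 1) :
    blockSymbol p r μ ∈ spectrum ℂ (blockSum x y) := by
  refine mem_spectrum_of_forall_exists_norm_sub_le fun ε hε => ?_
  obtain ⟨N, hN⟩ := exists_nat_gt ((8 * ‖r‖ / ε) ^ 2)
  have hN0 : 0 < √(N : ℝ) := Real.sqrt_pos.2 ((sq_nonneg _).trans_lt hN)
  have hrN : 8 * ‖r‖ ≤ ε * √N := by
    rw [← div_le_iff₀' hε]
    exact Real.le_sqrt_of_sq_le hN.le
  obtain ⟨m, hm⟩ := h _ (Metric.closedBall_mem_nhds _ (show 0 < ε / 8 by positivity)) (N + 1)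
  have hclose : ∀ n ∈ Set.Ico (m + 1 - 1) (m + 1 + N), ‖x n - p‖ ≤ ε / 8 ∧ ‖y n - r‖ ≤ ε / 8 := by
    intro n hn
    have := hm n (by push_cast; grind)
    rwa [Metric.mem_closedBall, Prod.dist_eq, max_le_iff, dist_eq_norm, dist_eq_norm] at this
  have hv := norm_planeWave hμ (m + 1) N
  refine ⟨planeWave μ (m + 1) N, norm_pos_iff.1 (hv ▸ hN0), ?_⟩
  rw [hv]
  linarith [norm_blockSum_planeWave_sub_le (by positivity) hclose hμ]

end PlaneWave

section CMV

open scoped BoundedContinuousFunction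
open BoundedContinuousFunction (const)

/-- The Verblunsky coefficients as a bounded sequence of complex numbers. -/
noncomputable def verblunskySeq (α : ℤ → Disk) : ℤ →ᵇ ℂ :=
  BoundedContinuousFunction.ofNormedAddCommGroupDiscrete (fun n => (α n : ℂ)) 1
    fun n => norm_disk_le (α n)

/-- The sequence `ρ_n = (1 - |α_n|²)^{1/2}` as a bounded sequence of complex numbers. -/
noncomputable def rhoSeq (α : ℤ → Disk) : ℤ →ᵇ ℂ :=
  BoundedContinuousFunction.ofNormedAddCommGroupDiscrete (fun n => rho (α n)) 1
    fun n => norm_rho_le (α n)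

theorem verblunskySeq_apply (α : ℤ → Disk) (n : ℤ) : verblunskySeq α n = α n := rfl

theorem rhoSeq_apply (α : ℤ → Disk) (n : ℤ) : rhoSeq α n = rho (α n) := rfl

theorem star_rho (α : Disk) : star (rho α) = rho α := Complex.conj_ofReal _

theorem norm_sq_add_norm_sq_rho (α : Disk) : ‖(α : ℂ)‖ ^ 2 + ‖rho α‖ ^ 2 = 1 := by
  have h : ‖(α : ℂ)‖ ^ 2 ≤ 1 := pow_le_one₀ (norm_nonneg _) (norm_disk_le α)
  rw [rho, Complex.norm_real, Real.norm_eq_abs, sq_abs, Real.sq_sqrt (by linarith)]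
  ring

theorem continuous_rho : Continuous rho := by
  unfold rho
  fun_prop

theorem cmvApply_of_even (α : ℤ → Disk) (ψ : ℤ → ℂ) {n : ℤ} (hn : Even n) :
    cmvApply α ψ n = star (α n : ℂ) * rho (α (n - 1)) * ψ (n - 1)
      - star (α n : ℂ) * α (n - 1) * ψ n + star (α (n + 1) : ℂ) * rho (α n) * ψ (n + 1)
      + rho (α (n + 1)) * rho (α n) * ψ (n + 2) := by
  have hI : Finset.Icc (-2 : ℤ) 2 = {-2, -1, 0, 1, 2} := rfl
  simp [cmvApply, hI, cmvMatrix, hn, sub_eq_add_neg]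
  ring

theorem cmvApply_of_not_even (α : ℤ → Disk) (ψ : ℤ → ℂ) {n : ℤ} (hn : ¬ Even n) :
    cmvApply α ψ n = rho (α (n - 1)) * rho (α (n - 2)) * ψ (n - 2)
      - rho (α (n - 1)) * α (n - 2) * ψ (n - 1) - star (α n : ℂ) * α (n - 1) * ψ n
      - rho (α n) * α (n - 1) * ψ (n + 1) := by
  have hI : Finset.Icc (-2 : ℤ) 2 = {-2, -1, 0, 1, 2} := rfl
  simp [cmvApply, hI, cmvMatrix, hn, sub_eq_add_neg]
  ring

theorem extendedCMV_eq_blockOp_mul_blockOp (α : ℤ → Disk) :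
    extendedCMV α = blockOp 0 (verblunskySeq α) (rhoSeq α) *
      blockOp 1 (verblunskySeq α) (rhoSeq α) := by
  ext ψ n
  rw [extendedCMV_apply]
  change _ = blockApply 0 (verblunskySeq α) (rhoSeq α)
    (blockApply 1 (verblunskySeq α) (rhoSeq α) ψ) n
  by_cases hn : Even n
  · rw [cmvApply_of_even α ψ hn, blockApply_of_even (by grind), blockApply_of_not_even (by grind),
      blockApply_of_even (by grind), add_assoc n 1 1]
    simp only [verblunskySeq_apply, rhoSeq_apply, star_rho, one_add_one_eq_two]
    ring
  · rw [cmvApply_of_not_even α ψ hn, blockApply_of_not_even (by grind),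
      blockApply_of_not_even (by grind), blockApply_of_even (by grind), sub_sub n 1 1]
    simp only [verblunskySeq_apply, rhoSeq_apply, star_rho, one_add_one_eq_two]
    ring

/-- The invertible operator with inverse given by the blocks `!![x n, conj y n; y n, -conj x n]`. -/
noncomputable def blockUnit (s : ℤ) {x y : ℤ →ᵇ ℂ} (h : ∀ n, ‖x n‖ ^ 2 + ‖y n‖ ^ 2 = 1) :
    (EllTwo →L[ℂ] EllTwo)ˣ where
  val := blockOp s x y
  inv := blockOp s (star x) y
  val_inv := blockOp_mul_blockOp_star s h
  inv_val := by simpa using blockOp_mul_blockOp_star s (x := star x) (y := y) (by simpa using h)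

theorem norm_blockUnit_le (s : ℤ) {x y : ℤ →ᵇ ℂ} (h : ∀ n, ‖x n‖ ^ 2 + ‖y n‖ ^ 2 = 1) :
    ‖(blockUnit s h : EllTwo →L[ℂ] EllTwo)‖ ≤ 1 :=
  norm_blockOp_le zero_le_one (fun n => by rw [h, one_pow]) s

theorem norm_blockUnit_inv_le (s : ℤ) {x y : ℤ →ᵇ ℂ} (h : ∀ n, ‖x n‖ ^ 2 + ‖y n‖ ^ 2 = 1) :
    ‖(↑(blockUnit s h)⁻¹ : EllTwo →L[ℂ] EllTwo)‖ ≤ 1 :=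
  norm_blockOp_le zero_le_one (fun n => by simp [h]) s

theorem norm_eq_one_of_mem_spectrum_extendedCMV {α : ℤ → Disk} {z : ℂ}
    (hz : z ∈ spectrum ℂ (extendedCMV α)) : ‖z‖ = 1 := by
  have h : ∀ n, ‖verblunskySeq α n‖ ^ 2 + ‖rhoSeq α n‖ ^ 2 = 1 := fun n =>
    norm_sq_add_norm_sq_rho (α n)
  refine norm_eq_one_of_mem_spectrum (u := blockUnit 0 h * blockUnit 1 h) ?_ ?_
    (by rwa [extendedCMV_eq_blockOp_mul_blockOp] at hz)
  · exact (norm_mul_le_of_le (norm_blockUnit_le 0 h) (norm_blockUnit_le 1 h)).trans_eq (one_mul 1)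
  · rw [mul_inv_rev, Units.val_mul]
    exact (norm_mul_le_of_le (norm_blockUnit_inv_le 1 h)
      (norm_blockUnit_inv_le 0 h)).trans_eq (one_mul 1)

theorem mem_spectrum_extendedCMV_iff {α : ℤ → Disk} (hα : ∀ n, star (α n : ℂ) = α n) {z : ℂ}
    (hz : ‖z‖ = 1) : z ∈ spectrum ℂ (extendedCMV α) ↔
      ((2 + 2 * z.re : ℝ) : ℂ) ∈ spectrum ℂ (blockSum (verblunskySeq α) (rhoSeq α) ^ 2) := by
  have hsq : ∀ s, blockOp s (verblunskySeq α) (rhoSeq α) * blockOp s (verblunskySeq α) (rhoSeq α)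
      = 1 := fun s => by
    have hstar : star (verblunskySeq α) = verblunskySeq α := by ext n; exact hα n
    simpa [hstar] using blockOp_mul_blockOp_star s (x := verblunskySeq α) (y := rhoSeq α)
      fun n => norm_sq_add_norm_sq_rho (α n)
  have hre : ((2 + 2 * z.re : ℝ) : ℂ) = 2 + z + z⁻¹ := by
    rw [Complex.inv_eq_conj hz, add_assoc, Complex.add_conj]
    push_cast
    ring
  rw [extendedCMV_eq_blockOp_mul_blockOp, hre, blockSum]
  exact mem_spectrum_mul_iff_of_mul_self_eq_one (hsq 0) (hsq 1) (norm_ne_zero_iff.1 (by simp [hz]))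

theorem norm_sub_sq_add_norm_rho_sq_le {α : Disk} {a : ℝ} (ha : 0 ≤ a) (h : a ≤ (α : ℂ).re) :
    ‖(α : ℂ) - a‖ ^ 2 + ‖rho α‖ ^ 2 ≤ 1 - a ^ 2 := by
  have hsub : ‖(α : ℂ) - a‖ ^ 2 = ‖(α : ℂ)‖ ^ 2 - 2 * a * (α : ℂ).re + a ^ 2 := by
    simp only [Complex.sq_norm, Complex.normSq_apply, Complex.sub_re, Complex.sub_im,
      Complex.ofReal_re, Complex.ofReal_im]
    ring
  rw [hsub]
  nlinarith [norm_sq_add_norm_sq_rho α]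

theorem norm_blockSum_verblunskySeq_le {α : ℤ → Disk} {a : ℝ} (ha : 0 ≤ a)
    (h : ∀ n, a ≤ (α n : ℂ).re) :
    ‖blockSum (verblunskySeq α) (rhoSeq α)‖ ≤ 2 * √(1 - a ^ 2) := by
  rw [← blockSum_sub_const_ofReal _ _ a]
  refine norm_blockSum_le (Real.sqrt_nonneg _) fun n => ?_
  have hn := norm_sub_sq_add_norm_rho_sq_le ha (h n)
  rwa [Real.sq_sqrt ((by positivity : (0 : ℝ) ≤ _).trans hn)]

theorem re_le_of_mem_spectrum_extendedCMV {α : ℤ → Disk} (hα : ∀ n, star (α n : ℂ) = α n) {a : ℝ}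
    (ha : 0 ≤ a) (h : ∀ n, a ≤ (α n : ℂ).re) {z : ℂ} (hz : z ∈ spectrum ℂ (extendedCMV α)) :
    z.re ≤ 1 - 2 * a ^ 2 := by
  let J := blockSum (verblunskySeq α) (rhoSeq α)
  have hmem := (mem_spectrum_extendedCMV_iff hα (norm_eq_one_of_mem_spectrum_extendedCMV hz)).1 hz
  have ha1 : a ≤ 1 := (h 0).trans ((Complex.re_le_norm _).trans (norm_disk_le _))
  have : 2 + 2 * z.re ≤ 4 * (1 - a ^ 2) := calc
    2 + 2 * z.re ≤ ‖((2 + 2 * z.re : ℝ) : ℂ)‖ := by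
      rw [Complex.norm_real]
      exact Real.le_norm_self _
    _ ≤ ‖J ^ 2‖ := spectrum.norm_le_norm_of_mem hmem
    _ ≤ ‖J‖ ^ 2 := norm_pow_le J 2
    _ ≤ (2 * √(1 - a ^ 2)) ^ 2 := by
      gcongr
      exact norm_blockSum_verblunskySeq_le ha h
    _ = 4 * (1 - a ^ 2) := by
      rw [mul_pow, Real.sq_sqrt (by nlinarith)]
      ring
  linarith

theorem blockSymbol_exp_mul_I {p r : ℂ} (hp : star p = p) (hr : star r = r) (θ : ℝ) :
    blockSymbol p r (Complex.exp (θ * Complex.I)) = 2 * r * Real.cos θ := by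
  rw [blockSymbol, hp, hr, ← Complex.exp_neg, Complex.ofReal_cos, Complex.cos]
  ring_nf

theorem exists_mul_cos_sq_eq {r t : ℝ} (ht : 0 ≤ t) (h : t ≤ r ^ 2) :
    ∃ θ : ℝ, (r * Real.cos θ) ^ 2 = t := by
  rcases eq_or_ne r 0 with rfl | hr
  · exact ⟨0, by linarith⟩
  have hle : |√t / r| ≤ 1 := by
    rw [← sq_le_one_iff_abs_le_one, div_pow, Real.sq_sqrt ht]
    exact div_le_one_of_le₀ h (sq_nonneg r)
  refine ⟨Real.arccos (√t / r), ?_⟩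
  rw [Real.cos_arccos (abs_le.1 hle).1 (abs_le.1 hle).2, mul_div_cancel₀ _ hr, Real.sq_sqrt ht]

theorem mem_spectrum_extendedCMV_of_re_le {α : ℤ → Disk} (hα : ∀ n, star (α n : ℂ) = α n)
    {p : Disk} (hp : star (p : ℂ) = p) (h : HasStretchesNear α p) {z : ℂ} (hz : ‖z‖ = 1)
    (hre : z.re ≤ 1 - 2 * ‖(p : ℂ)‖ ^ 2) : z ∈ spectrum ℂ (extendedCMV α) := by
  obtain ⟨θ, hθ⟩ : ∃ θ : ℝ, (2 * rho p * Real.cos θ) ^ 2 = ((2 + 2 * z.re : ℝ) : ℂ) := by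
    have hlower : -1 ≤ z.re := hz ▸ (abs_le.1 (Complex.abs_re_le_norm z)).1
    obtain ⟨θ, hθ⟩ := exists_mul_cos_sq_eq (r := 2 * √(1 - ‖(p : ℂ)‖ ^ 2)) (t := 2 + 2 * z.re)
      (by linarith) (by rw [mul_pow, Real.sq_sqrt (by linarith)]; linarith)
    exact ⟨θ, by rw [← hθ, rho]; push_cast; rfl⟩
  have hJ : 2 * rho p * Real.cos θ ∈ spectrum ℂ (blockSum (verblunskySeq α) (rhoSeq α)) := by
    rw [← blockSymbol_exp_mul_I hp (star_rho p)]
    refine blockSymbol_mem_spectrum ?_ (Complex.norm_exp_ofReal_mul_I θ)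
    exact h.comp_continuousAt (f := fun β : Disk => ((β : ℂ), rho β))
      (continuous_subtype_val.prodMk continuous_rho).continuousAt
  rw [mem_spectrum_extendedCMV_iff hα hz, ← hθ]
  exact spectrum.pow_mem_pow _ 2 hJ

/-- The complement of the arc `R_a` in the unit circle, described through the real part: the
endpoints of `R_a` have real part `cos (2 arcsin a) = 1 - 2 a²`. -/
def gapComplement (a : ℝ) : Set ℂ := {z | ‖z‖ = 1 ∧ z.re ≤ 1 - 2 * a ^ 2}

theorem spectrum_extendedCMV_eq_gapComplement {α : ℤ → Disk} (hα : ∀ n, star (α n : ℂ) = α n)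
    {p : Disk} {a : ℝ} (hp : (p : ℂ) = a) (ha : 0 ≤ a) (hle : ∀ n, a ≤ (α n : ℂ).re)
    (h : HasStretchesNear α p) : spectrum ℂ (extendedCMV α) = gapComplement a := by
  ext z
  refine ⟨fun hz => ⟨norm_eq_one_of_mem_spectrum_extendedCMV hz,
    re_le_of_mem_spectrum_extendedCMV hα ha hle hz⟩, fun ⟨hz, hre⟩ => ?_⟩
  refine mem_spectrum_extendedCMV_of_re_le hα (hp ▸ Complex.conj_ofReal a) h hz ?_
  rwa [hp, Complex.norm_real, Real.norm_of_nonneg ha]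

end CMV

section Probability

open ProbabilityTheory

theorem iIndepSet_infinitePi_pi {ι κ : Type*} {X : ι → Type*} [∀ i, MeasurableSpace (X i)]
    (μ : ∀ i, Measure (X i)) [∀ i, IsProbabilityMeasure (μ i)] {S : κ → Finset ι}
    (hS : Pairwise (Function.onFun Disjoint S)) {U : ∀ i, Set (X i)}
    (hU : ∀ i, MeasurableSet (U i)) :
    iIndepSet (fun k => Set.pi (S k) U) (Measure.infinitePi μ) := by
  classical
  rw [iIndepSet_iff_meas_biInter fun k => .pi (S k).countable_toSet fun i _ => hU i]
  intro T
  have hInter : ⋂ k ∈ T, Set.pi (S k : Set ι) U = Set.pi (T.biUnion S : Finset ι) U := by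
    ext ω
    simp only [Set.mem_iInter, Set.mem_pi, Finset.mem_coe, Finset.mem_biUnion]
    grind
  simp only [hInter, Measure.infinitePi_pi _ fun i _ => hU i,
    Finset.prod_biUnion fun _ _ _ _ hkl => hS hkl]

theorem pairwise_disjoint_Ico_nat_mul (N : ℕ) :
    Pairwise (Function.onFun Disjoint fun k : ℕ => Finset.Ico ((k : ℤ) * N) (k * N + N)) := by
  refine pairwise_disjoint_on _ |>.2 fun k l hkl => ?_
  rw [Finset.disjoint_left]
  have : ((k : ℤ) + 1) * N ≤ l * N := by gcongr; exact_mod_cast hkl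
  simp only [Finset.mem_Ico]
  intro j hk hl
  linarith

variable {X : Type*} [MeasurableSpace X] (ν : Measure X) [IsProbabilityMeasure ν]

theorem ae_exists_forall_Ico_mem {U : Set X} (hU : MeasurableSet U) (hpos : ν U ≠ 0) (N : ℕ) :
    ∀ᵐ ω ∂Measure.infinitePi fun _ : ℤ => ν, ∃ m : ℤ, ∀ j ∈ Set.Ico m (m + N), ω j ∈ U := by
  let S : ℕ → Finset ℤ := fun k => Finset.Ico ((k : ℤ) * N) (k * N + N)
  let B : ℕ → Set (ℤ → X) := fun k => Set.pi (S k) fun _ => U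
  have hB : ∀ k, MeasurableSet (B k) := fun k => .pi (S k).countable_toSet fun _ _ => hU
  have hBν : ∀ k, Measure.infinitePi (fun _ : ℤ => ν) (B k) = ν U ^ N := fun k => by
    rw [Measure.infinitePi_pi _ fun _ _ => hU]
    simp [S]
  have hlim : Measure.infinitePi (fun _ : ℤ => ν) (Filter.limsup B Filter.atTop) = 1 :=
    measure_limsup_eq_one hB (iIndepSet_infinitePi_pi _ (pairwise_disjoint_Ico_nat_mul N)
      fun _ => hU) (by
        simpa only [hBν] using ENNReal.tsum_const_eq_top_of_ne_zero (pow_ne_zero N hpos))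
  have hmem : ∀ᵐ ω ∂Measure.infinitePi fun _ : ℤ => ν, ω ∈ Filter.limsup B Filter.atTop :=
    (prob_compl_eq_zero_iff (.measurableSet_limsup hB)).2 hlim
  filter_upwards [hmem] with ω hω
  obtain ⟨k, hk⟩ := (Filter.mem_limsup_iff_frequently_mem.1 hω).exists
  exact ⟨k * N, fun j hj => hk j (by simpa [S] using hj)⟩

variable [TopologicalSpace X] [SecondCountableTopology X]

theorem ae_forall_mem_support_hasStretchesNear [OpensMeasurableSpace X] :
    ∀ᵐ ω ∂Measure.infinitePi fun _ : ℤ => ν, ∀ p ∈ ν.support, HasStretchesNear ω p := by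
  let 𝓑 := TopologicalSpace.countableBasis X
  have h𝓑 := TopologicalSpace.isBasis_countableBasis X
  have hae : ∀ᵐ ω ∂Measure.infinitePi fun _ : ℤ => ν, ∀ V ∈ 𝓑, ∀ N : ℕ, ν V ≠ 0 →
      ∃ m : ℤ, ∀ j ∈ Set.Ico m (m + N), ω j ∈ V :=
    (ae_ball_iff (TopologicalSpace.countable_countableBasis X)).2 fun V hV => ae_all_iff.2 fun N =>
      Filter.eventually_imp_distrib_left.2 fun hpos =>
        ae_exists_forall_Ico_mem ν (h𝓑.isOpen hV).measurableSet hpos N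
  filter_upwards [hae] with ω hω p hp U hU N
  obtain ⟨V, hV, hpV, hVU⟩ := h𝓑.mem_nhds_iff.1 hU
  have hpos : 0 < ν V :=
    (Measure.mem_support_iff_forall p).1 hp V ((h𝓑.isOpen hV).mem_nhds hpV)
  obtain ⟨m, hm⟩ := hω V hV N hpos.ne'
  exact ⟨m, fun j hj => hVU (hm j hj)⟩

theorem ae_forall_apply_mem_support {ι : Type*} [Countable ι] :
    ∀ᵐ ω ∂Measure.infinitePi fun _ : ι => ν, ∀ i, ω i ∈ ν.support :=
  ae_all_iff.2 fun i =>
    (measurePreserving_eval_infinitePi (fun _ : ι => ν) i).quasiMeasurePreserving.ae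
      Measure.support_mem_ae

end Probability

section Arcs

theorem cos_two_mul_arcsin {a : ℝ} (ha : -1 ≤ a) (ha' : a ≤ 1) :
    Real.cos (2 * Real.arcsin a) = 1 - 2 * a ^ 2 := by
  rw [Real.cos_two_mul, Real.cos_arcsin, Real.sq_sqrt (by nlinarith)]
  ring

theorem cos_le_iff_two_mul_arcsin_le_abs {a θ : ℝ} (ha : 0 ≤ a) (ha' : a ≤ 1) (hθ : |θ| ≤ Real.pi) :
    Real.cos θ ≤ 1 - 2 * a ^ 2 ↔ 2 * Real.arcsin a ≤ |θ| := by
  rw [← Real.cos_abs θ, ← cos_two_mul_arcsin (by linarith) ha']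
  exact Real.strictAntiOn_cos.le_iff_ge ⟨abs_nonneg θ, hθ⟩
    ⟨by linarith [Real.arcsin_nonneg.2 ha], by linarith [Real.arcsin_le_pi_div_two a]⟩

theorem exists_mem_Ico_eq_exp_of_norm_eq_one {z : ℂ} (hz : ‖z‖ = 1) :
    ∃ θ ∈ Set.Ico (-Real.pi) Real.pi, z = Complex.exp (θ * Complex.I) := by
  obtain ⟨θ, hθ, rfl⟩ := Complex.norm_eq_one_iff'.1 hz
  rcases hθ.2.eq_or_lt with rfl | hlt
  · refine ⟨-Real.pi, ⟨le_rfl, by linarith [Real.pi_pos]⟩, ?_⟩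
    rw [Complex.ofReal_neg, neg_mul, Complex.exp_neg, Complex.exp_pi_mul_I, inv_neg_one]
  · exact ⟨θ, ⟨hθ.1.le, hlt⟩, rfl⟩

theorem exp_mul_I_mem_gapComplement_iff {a θ : ℝ} (ha : 0 ≤ a) (ha' : a ≤ 1) (hθ : |θ| ≤ Real.pi) :
    Complex.exp (θ * Complex.I) ∈ gapComplement a ↔ 2 * Real.arcsin a ≤ |θ| := by
  rw [← cos_le_iff_two_mul_arcsin_le_abs ha ha' hθ, gapComplement, Set.mem_ofPred_eq,
    Complex.exp_ofReal_mul_I_re]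
  exact and_iff_right (Complex.norm_exp_ofReal_mul_I θ)

theorem setOf_two_mul_arcsin_le_abs_eq_gapComplement {a : ℝ} (ha : 0 ≤ a) (ha' : a ≤ 1) :
    {z : ℂ | ∃ θ ∈ Set.Ico (-Real.pi) Real.pi,
      2 * Real.arcsin a ≤ |θ| ∧ z = Complex.exp (θ * Complex.I)} = gapComplement a := by
  ext z
  constructor
  · rintro ⟨θ, hθ, hle, rfl⟩
    exact (exp_mul_I_mem_gapComplement_iff ha ha' (abs_le.2 ⟨hθ.1, hθ.2.le⟩)).2 hle
  · intro hz
    obtain ⟨θ, hθ, rfl⟩ := exists_mem_Ico_eq_exp_of_norm_eq_one hz.1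
    exact ⟨θ, hθ, (exp_mul_I_mem_gapComplement_iff ha ha' (abs_le.2 ⟨hθ.1, hθ.2.le⟩)).1 hz, rfl⟩

theorem sphere_diff_gapArc_eq_gapComplement {a : ℝ} (ha : 0 ≤ a) (ha' : a ≤ 1) :
    Metric.sphere (0 : ℂ) 1 \ gapArc a = gapComplement a := by
  ext z
  constructor
  · rintro ⟨hz, hgap⟩
    obtain ⟨θ, hθ, rfl⟩ := exists_mem_Ico_eq_exp_of_norm_eq_one (mem_sphere_zero_iff_norm.1 hz)
    rw [exp_mul_I_mem_gapComplement_iff ha ha' (abs_le.2 ⟨hθ.1, hθ.2.le⟩)]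
    by_contra! hlt
    exact hgap ⟨θ, (abs_lt.1 hlt).1, (abs_lt.1 hlt).2, rfl⟩
  · refine fun hz => ⟨mem_sphere_zero_iff_norm.2 hz.1, ?_⟩
    rintro ⟨θ, h1, h2, rfl⟩
    have hlt : |θ| < 2 * Real.arcsin a := abs_lt.2 ⟨h1, h2⟩
    have hπ : |θ| ≤ Real.pi := by linarith [Real.arcsin_le_pi_div_two a]
    exact hlt.not_ge ((exp_mul_I_mem_gapComplement_iff ha ha' hπ).1 hz)

theorem isClosed_gapComplement (a : ℝ) : IsClosed (gapComplement a) :=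
  (isClosed_eq continuous_norm continuous_const).inter
    (isClosed_le Complex.continuous_re continuous_const)

theorem gapComplement_subset_sphere (a : ℝ) : gapComplement a ⊆ Metric.sphere 0 1 :=
  fun _ hz => mem_sphere_zero_iff_norm.2 hz.1

end Arcs

section Support

theorem exists_isMinOn_norm_of_isClosed {E : Type*} [NormedAddCommGroup E] [ProperSpace E] {r : ℝ}
    {S : Set (Metric.ball (0 : E) r)} (hS : IsClosed S) (hne : S.Nonempty) :
    ∃ p ∈ S, IsMinOn (fun v : Metric.ball (0 : E) r => ‖(v : E)‖) S p := by
  obtain ⟨v₀, hv₀⟩ := hne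
  let K : Set (Metric.ball (0 : E) r) := Subtype.val ⁻¹' Metric.closedBall 0 ‖(v₀ : E)‖
  have hK : IsCompact K := by
    refine (Topology.IsInducing.subtypeVal.isCompact_preimage_iff fun v hv => ?_).2
      (isCompact_closedBall _ _)
    rw [Subtype.range_coe]
    exact Metric.closedBall_subset_ball (mem_ball_zero_iff.1 v₀.2) hv
  refine ContinuousOn.exists_isMinOn' (by fun_prop) hS hv₀ (Filter.Eventually.filter_mono
    inf_le_left ?_)
  filter_upwards [hK.compl_mem_cocompact] with v hv
  exact le_of_not_ge fun hle => hv (mem_closedBall_zero_iff.2 hle)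

theorem exists_mem_support_isLeast_realSupport {ν : Measure Disk} (hν0 : ν ≠ 0)
    (hν : ∀ α ∈ ν.support, ∃ t ∈ Set.Icc (0 : ℝ) 1, (α : ℂ) = (t : ℂ)) :
    ∃ p ∈ ν.support, ∃ a ∈ Set.Icc (0 : ℝ) 1, (p : ℂ) = a ∧ IsLeast (realSupport ν) a := by
  obtain ⟨p, hp, hmin⟩ := exists_isMinOn_norm_of_isClosed Measure.isClosed_support
    (Measure.nonempty_support hν0)
  obtain ⟨a, ha, hpa⟩ := hν p hp
  refine ⟨p, hp, a, ha, hpa, ⟨p, hp, hpa⟩, ?_⟩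
  rintro t ⟨α, hα, hαt⟩
  obtain ⟨s, hs, hαs⟩ := hν α hα
  obtain rfl : s = t := Complex.ofReal_injective (hαs.symm.trans hαt)
  simpa [hpa, hαs, abs_of_nonneg ha.1, abs_of_nonneg hs.1] using hmin hα

end Support

theorem theorem1p1 (ν : Measure Disk) [IsProbabilityMeasure ν]
    (hν : ∀ α ∈ ν.support, ∃ t ∈ Set.Icc (0 : ℝ) 1, (α : ℂ) = (t : ℂ)) :
    ∃ a : ℝ, IsLeast (realSupport ν) a ∧
      IsAlmostSureSpectrum ν
        {z : ℂ | ∃ θ ∈ Set.Ico (-Real.pi) Real.pi,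
          2 * Real.arcsin a ≤ |θ| ∧ z = Complex.exp (θ * Complex.I)} ∧
      IsAlmostSureSpectrum ν (Metric.sphere (0 : ℂ) 1 \ gapArc a) := by
  obtain ⟨p, hp, a, ⟨ha, ha'⟩, hpa, hleast⟩ :=
    exists_mem_support_isLeast_realSupport (IsProbabilityMeasure.ne_zero ν) hν
  refine ⟨a, hleast, ?_⟩
  rw [setOf_two_mul_arcsin_le_abs_eq_gapComplement ha ha',
    sphere_diff_gapArc_eq_gapComplement ha ha', and_self]
  refine ⟨isClosed_gapComplement a, gapComplement_subset_sphere a, ?_⟩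
  filter_upwards [ae_forall_apply_mem_support ν, ae_forall_mem_support_hasStretchesNear ν]
    with ω hmem hstretch
  choose t _ hωt using fun n => hν (ω n) (hmem n)
  refine spectrum_extendedCMV_eq_gapComplement (fun n => ?_) hpa ha (fun n => ?_) (hstretch p hp)
  · rw [hωt]
    exact Complex.conj_ofReal _
  · rw [hωt, Complex.ofReal_re]
    exact hleast.2 ⟨ω n, hmem n, hωt n⟩
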